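/- Let $k\ge 1$ be an integer. An oscillating tableau of length $n$ is a sequence $\emptyset=\lambda^0,\lambda^1,\dots,\lambda^n$ of Ferrers diagrams in which each $\lambda^{i}$ ($1\le i\le n$) is obtained from $\lambda^{i-1}$ by adding or deleting exactly one box; its height is bounded by $k$ if every $\lambda^i$ has at most $k$ rows, and it ends in a row shape if $\lambda^n=(m)$ for some $m\ge 0$, where $(0)=\emptyset$. Let $o_k(n)$ be the number of oscillating tableaux of length $n$ and height bounded by $k$ that end in a row shape, and let \[ \tilde O_k(t)=\sum_{n\ge 0} o_k(n)\,\frac{t^n}{n!}. \] For $j\in\mathbb Z$ let \[ b_j(t)=I_j(2t)=\sum_{a\ge \max(0,-j)}\frac{t^{2a+j}}{a!\,(a+j)!}, \] where $I_j$ is the hyperbolic (modified) Bessel function of the first kind of order $j$. Then, as formal power series in $t$, \[ \tilde O_k(t)=\sum_{u=0}^{k-1}(-1)^u\left(\sum_{\ell=u}^{2k-1-u} b_\ell(t)\right)\det\bigl(b_{i-j}(t)-b_{2k-i-j}(t)\bigr)_{0\le i\le k-1,\ i\ne u;\ 1\le j\le k-1}, \] where the indices $i$ and $j$ of the $(k-1)\times(k-1)$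 determinant are taken in increasing order, and the empty determinant (for $k=1$) equals $1$. -/

import Mathlib

/-- `ν` is obtained from `μ` by adding one box. -/
def AddsBox (μ ν : YoungDiagram) : Prop :=
  μ ≤ ν ∧ ν.card = μ.card + 1

/-- The number of rows of a Ferrers diagram. -/
def diagramHeight (μ : YoungDiagram) : ℕ :=
  μ.colLen 0

/-- `μ` is a row shape `(m)` for some `m ≥ 0`; the case `m = 0` is the empty shape. -/
def IsRowShape (μ : YoungDiagram) : Prop :=
  ∃ m : ℕ, ∀ c : ℕ × ℕ, c ∈ μ ↔ c.1 = 0 ∧ c.2 < m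

/-- A sequence `T 0, …, T n` of Ferrers diagrams is an oscillating tableau of length `n`: it starts
at the empty shape, and at each of the `n` steps one box is either added or deleted. -/
def IsOscillatingTableau {n : ℕ} (T : Fin (n + 1) → YoungDiagram) : Prop :=
  T 0 = ⊥ ∧ ∀ i : Fin n, AddsBox (T i.castSucc) (T i.succ) ∨ AddsBox (T i.succ) (T i.castSucc)

/-- Oscillating tableaux of length `n`, of height bounded by `k`, ending in a row shape. -/
def rowOscillatingTableaux (k n : ℕ) : Set (Fin (n + 1) → YoungDiagram) :=
  {T | IsOscillatingTableau T ∧ (∀ i, diagramHeight (T i) ≤ k) ∧ IsRowShape (T (Fin.last n))}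

/-- The exponential generating function, by length, of oscillating tableaux of height bounded by
`k` that end in a row shape. -/
noncomputable def rowOscillatingEGF (k : ℕ) : PowerSeries ℚ :=
  PowerSeries.mk fun n => ((rowOscillatingTableaux k n).ncard : ℚ) / (n.factorial : ℚ)

/-- The power series of the hyperbolic (modified) Bessel function of the first kind of integer
order `j`, `I_j(x) = ∑_a (x/2)^(2a+j) / (a! (a+j)!)`, the sum being over all `a ≥ 0` with
`a + j ≥ 0`. The coefficient of `x^p` collects the pairs `(a, a + j)` with sum `p`. -/
noncomputable def besselI (j : ℤ) : PowerSeries ℚ :=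
  PowerSeries.mk fun p => ∑ q ∈ Finset.HasAntidiagonal.antidiagonal p,
    if (q.2 : ℤ) = (q.1 : ℤ) + j then
      (1 / 2 : ℚ) ^ p / ((q.1.factorial : ℚ) * (q.2.factorial : ℚ))
    else 0

/-- The series `b_j(t) = I_j(2t)`. -/
noncomputable def besselB (j : ℤ) : PowerSeries ℚ :=
  PowerSeries.rescale (2 : ℚ) (besselI j)

/-- The `r`-th element, counted from `0`, of `ℕ \ {u}` in increasing order. -/
def skipIndex (u r : ℕ) : ℕ :=
  if r < u then r else r + 1

/-- The matrix `(b_{i-j} - b_{2k-i-j})` with `i` running through `{0, …, k-1} \ {u}` and `j` through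
`{1, …, k-1}`, both in increasing order. -/
noncomputable def rowMinor (k u : ℕ) : Matrix (Fin (k - 1)) (Fin (k - 1)) (PowerSeries ℚ) :=
  Matrix.of fun r c =>
    let i : ℤ := (skipIndex u (r : ℕ) : ℤ)
    let j : ℤ := ((c : ℕ) : ℤ) + 1
    besselB (i - j) - besselB (2 * (k : ℤ) - i - j)

/-!
Adding `(k, k - 1, …, 1)` to the row lengths turns Ferrers diagrams with at most `k` rows into the
lattice points of the open Weyl chamber of type `C`, and oscillating tableaux into walks with unit
steps that stay in the chamber. The generating functions of the walks from `a` to `x` are determined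
by a linear system: the derivative of the one at `x` is the sum of those at the neighbors of `x` in
the chamber, and the constant term is `1` if `x = a` and `0` otherwise. Since `b_j' = b_{j-1} +
b_{j+1}`, the determinants `F_x = det (b_{a_i - x_j} - b_{a_i + x_j})` satisfy `F_x' = ∑ F_y` over
*all* lattice neighbors `y` of `x`. This is the same system, because a neighbor outside the chamber
has two equal coordinates or a zero coordinate, and then its determinant has two equal columns or a
zero column.

For `x` the point of the row shape `(m)`, only the first column depends on `m`. Expanding along it
and summing over `m`, the differences of Bessel series telescope.
-/

open PowerSeries
open Finset.HasAntidiagonal (antidiagonal mem_antidiagonal)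
open scoped Nat PowerSeries.WithPiTopology

/-! ### The Bessel series -/

/-- The contribution `1 / (a! b!)` of the pair `q = (a, b)` to the coefficient of `t ^ (a + b)` in
`b_j(t)`; it is zero unless `b = a + j`. -/
def besselTerm (j : ℤ) (q : ℕ × ℕ) : ℚ :=
  if (q.2 : ℤ) = q.1 + j then 1 / ((q.1 ! : ℚ) * q.2 !) else 0

theorem coeff_besselB (j : ℤ) (p : ℕ) :
    coeff p (besselB j) = ∑ q ∈ antidiagonal p, besselTerm j q := by
  rw [besselB, coeff_rescale, besselI, coeff_mk, Finset.mul_sum]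
  refine Finset.sum_congr rfl fun q _ => ?_
  rw [besselTerm, mul_ite, mul_zero, ← mul_div_assoc, ← mul_pow, mul_one_div_cancel two_ne_zero,
    one_pow]

theorem besselTerm_swap (j : ℤ) (q : ℕ × ℕ) : besselTerm j q.swap = besselTerm (-j) q := by
  have swap_iff : (q.1 : ℤ) = q.2 + j ↔ (q.2 : ℤ) = q.1 + -j := by lia
  simp only [besselTerm, Prod.fst_swap, Prod.snd_swap, swap_iff, mul_comm (q.2 ! : ℚ)]

theorem besselTerm_succ_right (j : ℤ) (a b : ℕ) :
    besselTerm j (a, b + 1) * (b + 1) = besselTerm (j - 1) (a, b) := by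
  have succ_iff : ((b + 1 : ℕ) : ℤ) = a + j ↔ (b : ℤ) = a + (j - 1) := by lia
  have succ_ne_zero : (b + 1 : ℚ) ≠ 0 := b.cast_add_one_ne_zero
  rw [besselTerm, besselTerm, if_congr succ_iff rfl rfl, ite_mul, zero_mul, Nat.factorial_succ]
  push_cast
  field_simp

theorem besselTerm_succ_left (j : ℤ) (a b : ℕ) :
    besselTerm j (a + 1, b) * (a + 1) = besselTerm (j + 1) (a, b) := by
  have h := besselTerm_succ_right (-j) b a
  rwa [← besselTerm_swap, ← neg_add', ← besselTerm_swap] at h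

theorem besselB_neg (j : ℤ) : besselB (-j) = besselB j := by
  ext p
  simp only [coeff_besselB, ← besselTerm_swap]
  exact Finset.Nat.sum_antidiagonal_swap

theorem derivative_besselB (j : ℤ) :
    d⁄dX ℚ (besselB j) = besselB (j - 1) + besselB (j + 1) := by
  ext p
  have split_weight : ∀ q ∈ antidiagonal (p + 1),
      besselTerm j q * (p + 1) = besselTerm j q * q.2 + besselTerm j q * q.1 := by
    intro q hq
    have weight_eq : (q.1 + q.2 : ℚ) = p + 1 := mod_cast mem_antidiagonal.1 hq
    rw [← weight_eq]
    ring
  rw [coeff_derivative, coeff_besselB, Finset.sum_mul, Finset.sum_congr rfl split_weight,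
    Finset.sum_add_distrib,
    Finset.Nat.sum_antidiagonal_succ' (f := fun q => besselTerm j q * (q.2 : ℚ)),
    Finset.Nat.sum_antidiagonal_succ (f := fun q => besselTerm j q * (q.1 : ℚ))]
  simp only [Nat.cast_zero, mul_zero, zero_add, Nat.cast_succ, besselTerm_succ_right,
    besselTerm_succ_left, map_add, coeff_besselB]

theorem constantCoeff_besselB (j : ℤ) :
    constantCoeff (besselB j) = if j = 0 then 1 else 0 := by
  simp [← coeff_zero_eq_constantCoeff_apply, coeff_besselB, besselTerm, eq_comm]

theorem coeff_besselB_eq_zero {j : ℤ} {p : ℕ} (h : p < j) : coeff p (besselB j) = 0 := by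
  rw [coeff_besselB]
  refine Finset.sum_eq_zero fun q hq => if_neg ?_
  have := mem_antidiagonal.1 hq
  lia

theorem summable_besselB_natCast : Summable fun l : ℕ => besselB l := by
  refine (WithPiTopology.summable_iff_summable_coeff ℚ).2 fun n => ?_
  refine summable_of_ne_finset_zero (s := Finset.range (n + 1)) fun l hl => ?_
  exact coeff_besselB_eq_zero (by simpa using hl)

theorem hasSum_sub_shift {G : Type*} [AddCommGroup G] [TopologicalSpace G]
    [IsTopologicalAddGroup G] {f : ℕ → G} (hf : Summable f) {u v : ℕ} (huv : u ≤ v) :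
    HasSum (fun m => f (m + u) - f (m + v)) (∑ l ∈ Finset.Ico u v, f l) := by
  obtain ⟨a, ha⟩ := hf
  have h := ((hasSum_nat_add_iff' u).2 ha).sub ((hasSum_nat_add_iff' v).2 ha)
  rwa [sub_sub_sub_cancel_left, ← Finset.sum_Ico_eq_sub f huv] at h

/-! ### Derivations and determinants -/

section Derivation

variable {R A ι : Type*} [CommRing R] [CommRing A] [Algebra R A] [DecidableEq ι]

theorem derivation_prod {M : Type*} [AddCommGroup M] [Module A M] [Module R M]
    (D : Derivation R A M) (s : Finset ι) (f : ι → A) :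
    D (∏ i ∈ s, f i) = ∑ j ∈ s, (∏ i ∈ s.erase j, f i) • D (f j) := by
  induction s using Finset.induction_on with
  | empty => simp
  | insert a s ha ih =>
    rw [Finset.prod_insert ha, D.leibniz, Finset.sum_insert ha, Finset.erase_insert ha, ih,
      add_comm, Finset.smul_sum]
    congr 1
    refine Finset.sum_congr rfl fun j hj => ?_
    have haj : a ≠ j := fun h => ha (h ▸ hj)
    rw [Finset.erase_insert_of_ne haj,
      Finset.prod_insert (fun h => ha (Finset.mem_of_mem_erase h)), mul_smul]

theorem derivation_det [Fintype ι] (D : Derivation R A A) (M : Matrix ι ι A) :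
    D M.det = ∑ j, (M.updateCol j fun i => D (M i j)).det := by
  simp only [Matrix.det_apply, map_sum]
  rw [Finset.sum_comm]
  refine Finset.sum_congr rfl fun σ _ => ?_
  rw [← Finset.smul_sum, Units.smul_def, Units.smul_def, map_zsmul, derivation_prod]
  congr 1
  refine Finset.sum_congr rfl fun j _ => ?_
  rw [← Finset.prod_erase_mul _ _ (Finset.mem_univ j), Matrix.updateCol_self, smul_eq_mul]
  congr 1
  exact Finset.prod_congr rfl fun i hi =>
    (Matrix.updateCol_ne (Finset.ne_of_mem_erase hi)).symm

end Derivation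

/-! ### Counting paths by a system of linear differential equations -/

section Paths

variable {V : Type*} {S : Set V} {r : V → V → Prop} {n : ℕ} {v w : V}

/-- The paths from `v` to `w` with `n` steps that are related by `r` and all `n + 1` points in
`S`. -/
def pathsIn (S : Set V) (r : V → V → Prop) (n : ℕ) (v w : V) : Set (Fin (n + 1) → V) :=
  {p | p 0 = v ∧ p (Fin.last n) = w ∧ (∀ i, p i ∈ S) ∧ ∀ i : Fin n, r (p i.castSucc) (p i.succ)}

theorem pairwise_disjoint_pathsIn : Pairwise fun w w' =>
    Disjoint (pathsIn S r n v w) (pathsIn S r n v w') :=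
  fun _ _ hne => Set.disjoint_left.2 fun _ hp hp' => hne (hp.2.1.symm.trans hp'.2.1)

theorem pathsIn_zero [DecidableEq V] (hw : w ∈ S) :
    pathsIn S r 0 v w = if w = v then {fun _ => w} else ∅ := by
  ext p
  split_ifs with hwv
  · subst hwv
    rw [Set.mem_singleton_iff]
    refine ⟨fun hp => funext (Fin.forall_fin_one.2 hp.1), ?_⟩
    rintro rfl
    exact ⟨rfl, rfl, fun _ => hw, fun i => i.elim0⟩
  · exact iff_of_false (fun hp => hwv (hp.2.1.symm.trans hp.1)) (Set.notMem_empty p)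

theorem pathsIn_succ (hw : w ∈ S) :
    pathsIn S r (n + 1) v w =
      ⋃ u ∈ {u ∈ S | r u w}, (Fin.snoc (α := fun _ => V) · w) '' pathsIn S r n v u := by
  ext p
  simp only [Set.mem_iUnion, exists_prop]
  constructor
  · rintro ⟨hv, hlast, hS, hr⟩
    refine ⟨p (Fin.last n).castSucc, ⟨hS _, ?_⟩, Fin.init p,
      ⟨hv, rfl, fun i => hS _, fun i => hr i.castSucc⟩, ?_⟩
    · simpa only [Fin.succ_last, hlast] using hr (Fin.last n)
    · simp only [← hlast]
      exact Fin.snoc_init_self p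
  · rintro ⟨u, ⟨-, huw⟩, p, ⟨hv, rfl, hS, hr⟩, rfl⟩
    refine ⟨(Fin.snoc_castSucc (α := fun _ => V) w p 0).trans hv, Fin.snoc_last .., ?_, ?_⟩
    · refine Fin.lastCases ?_ fun i => ?_
      · simpa only [Fin.snoc_last] using hw
      · simpa only [Fin.snoc_castSucc] using hS i
    · refine Fin.lastCases ?_ fun i => ?_
      · simpa only [Fin.succ_last, Fin.snoc_castSucc, Fin.snoc_last] using huw
      · simpa only [← Fin.castSucc_succ, Fin.snoc_castSucc] using hr i

theorem finite_pathsIn (hfin : ∀ w ∈ S, {u ∈ S | r u w}.Finite) (hw : w ∈ S) :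
    (pathsIn S r n v w).Finite := by
  classical
  induction n generalizing w with
  | zero =>
    rw [pathsIn_zero hw]
    split_ifs
    exacts [Set.finite_singleton _, Set.finite_empty]
  | succ n ih =>
    rw [pathsIn_succ hw]
    exact (hfin w hw).biUnion fun u hu => (ih hu.1).image _

theorem ncard_pathsIn_succ (hfin : ∀ w ∈ S, {u ∈ S | r u w}.Finite) (hw : w ∈ S) :
    (pathsIn S r (n + 1) v w).ncard = ∑ᶠ u ∈ {u ∈ S | r u w}, (pathsIn S r n v u).ncard := by
  have snoc_injective := Fin.snoc_left_injective (n := n + 1) (α := fun _ => V) w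
  rw [pathsIn_succ hw, (hfin w hw).ncard_biUnion fun u hu => (finite_pathsIn hfin hu.1).image _]
  · exact finsum_mem_congr rfl fun u _ => Set.ncard_image_of_injective _ snoc_injective
  · exact fun u _ u' _ hne =>
      (Set.disjoint_image_iff snoc_injective).2 (pairwise_disjoint_pathsIn hne)

theorem ncard_pathsIn_eq_factorial_mul_coeff [DecidableEq V] {R : Type*} [CommRing R]
    {F : V → R⟦X⟧} (hfin : ∀ w ∈ S, {u ∈ S | r u w}.Finite)
    (hconst : ∀ w ∈ S, constantCoeff (F w) = if w = v then 1 else 0)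
    (hderiv : ∀ w ∈ S, d⁄dX R (F w) = ∑ᶠ u ∈ {u ∈ S | r u w}, F u) (hw : w ∈ S) :
    ((pathsIn S r n v w).ncard : R) = n ! * coeff n (F w) := by
  induction n generalizing w with
  | zero =>
    rw [pathsIn_zero hw, coeff_zero_eq_constantCoeff_apply, hconst w hw]
    split_ifs <;> simp
  | succ n ih =>
    calc ((pathsIn S r (n + 1) v w).ncard : R)
        = ∑ u ∈ (hfin w hw).toFinset, ((pathsIn S r n v u).ncard : R) := by
          rw [ncard_pathsIn_succ hfin hw, finsum_mem_eq_finite_toFinset_sum _ (hfin w hw),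
            Nat.cast_sum]
      _ = ∑ u ∈ (hfin w hw).toFinset, n ! * coeff n (F u) :=
          Finset.sum_congr rfl fun u hu => ih ((hfin w hw).mem_toFinset.1 hu).1
      _ = n ! * coeff n (d⁄dX R (F w)) := by
          rw [hderiv w hw, finsum_mem_eq_finite_toFinset_sum _ (hfin w hw), map_sum,
            Finset.mul_sum]
      _ = (n + 1)! * coeff (n + 1) (F w) := by
          rw [coeff_derivative, Nat.factorial_succ]
          push_cast
          ring

end Paths

/-! ### Lattice walks in the Weyl chamber of type `C` -/

section Walks

variable {ι : Type*}

/-- The lattice points of the open Weyl chamber of type `C`: for `ι = Fin k` these are the points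
with `x 0 > x 1 > ⋯ > x (k - 1) > 0`. -/
def weylChamber (ι : Type*) [Preorder ι] : Set (ι → ℤ) :=
  {x | StrictAnti x ∧ ∀ i, 0 < x i}

/-- The neighbor of the lattice point `x` in direction `s.1`, with sign `s.2`. -/
def latticeStep [DecidableEq ι] (x : ι → ℤ) (s : ι × ℤˣ) : ι → ℤ :=
  Function.update x s.1 (x s.1 + s.2)

/-- The Grabiner–Magyar matrix: for `a` and `x` in the Weyl chamber, its determinant is the
exponential generating function, by length, of the lattice walks from `a` to `x` that stay in the
chamber. -/
noncomputable def walkMatrix (a x : ι → ℤ) : Matrix ι ι ℚ⟦X⟧ :=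
  Matrix.of fun i j => besselB (a i - x j) - besselB (a i + x j)

theorem walkMatrix_update [DecidableEq ι] (a x : ι → ℤ) (j : ι) (c : ℤ) :
    walkMatrix a (Function.update x j c) =
      (walkMatrix a x).updateCol j fun i => besselB (a i - c) - besselB (a i + c) := by
  ext1 i l
  rcases eq_or_ne l j with rfl | hl
  · simp [walkMatrix]
  · simp [walkMatrix, hl]

theorem latticeStep_injective [DecidableEq ι] (x : ι → ℤ) :
    Function.Injective (latticeStep x) := by
  rintro ⟨i, ε⟩ ⟨j, δ⟩ h
  have h_at : latticeStep x (i, ε) i = latticeStep x (j, δ) i := congrFun h i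
  rcases eq_or_ne i j with rfl | hij
  · simpa [latticeStep, Units.val_inj] using h_at
  · simp [latticeStep, hij] at h_at

theorem eq_latticeStep_neg_iff [DecidableEq ι] {x y : ι → ℤ} {j : ι} {ε : ℤˣ} :
    y = latticeStep x (j, -ε) ↔ x = latticeStep y (j, ε) := by
  constructor <;> rintro rfl <;> simp [latticeStep]

theorem constantCoeff_walkMatrix {a x : ι → ℤ} (ha : ∀ i, 0 < a i) (hx : ∀ i, 0 < x i) (i j : ι) :
    constantCoeff (walkMatrix a x i j) = if a i = x j then 1 else 0 := by
  have sum_ne_zero : a i + x j ≠ 0 := (add_pos (ha i) (hx j)).ne'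
  simp [walkMatrix, constantCoeff_besselB, sub_eq_zero, sum_ne_zero]

variable [Fintype ι]

theorem derivative_det_walkMatrix [DecidableEq ι] (a x : ι → ℤ) :
    d⁄dX ℚ (walkMatrix a x).det = ∑ s, (walkMatrix a (latticeStep x s)).det := by
  rw [derivation_det, Fintype.sum_prod_type]
  refine Finset.sum_congr rfl fun j _ => ?_
  rw [UnitsInt.univ, Finset.sum_pair (by decide), latticeStep, latticeStep, walkMatrix_update,
    walkMatrix_update, ← Matrix.det_updateCol_add]
  congr 2
  funext i
  simp only [walkMatrix, Matrix.of_apply, map_sub, derivative_besselB, Pi.add_apply, Units.val_one,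
    Units.val_neg, sub_add_eq_sub_sub, ← sub_eq_add_neg, ← add_assoc, ← add_sub_assoc, ← sub_add]
  ring

theorem injective_of_det_walkMatrix_ne_zero [DecidableEq ι] {a x : ι → ℤ}
    (h : (walkMatrix a x).det ≠ 0) : Function.Injective x := by
  intro i j hij
  by_contra hne
  exact h (Matrix.det_zero_of_column_eq hne fun l => by simp [walkMatrix, hij])

theorem ne_zero_of_det_walkMatrix_ne_zero [DecidableEq ι] {a x : ι → ℤ}
    (h : (walkMatrix a x).det ≠ 0) (i : ι) : x i ≠ 0 := fun hi =>
  h (Matrix.det_eq_zero_of_column_eq_zero i fun l => by simp [walkMatrix, hi])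

end Walks

section LinearOrder

variable {ι : Type*} [LinearOrder ι]

theorem eq_of_strictAnti_of_range_subset [Finite ι] {α : Type*} [PartialOrder α] {f g : ι → α}
    (hf : StrictAnti f) (hg : StrictAnti g) (h : Set.range f ⊆ Set.range g) : f = g := by
  refine (hf.range_inj hg).1 (Set.eq_of_subset_of_ncard_le h ?_ (Set.finite_range g))
  rw [Set.ncard_range_of_injective hf.injective, Set.ncard_range_of_injective hg.injective]

theorem antitone_latticeStep {x : ι → ℤ} (hx : StrictAnti x) (s : ι × ℤˣ) :
    Antitone (latticeStep x s) := by
  refine antitone_iff_forall_lt.2 fun i j hij => ?_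
  have hlt := hx hij
  obtain ⟨l, ε⟩ := s
  rcases Int.units_eq_one_or ε with rfl | rfl <;>
    simp only [latticeStep, Function.update_apply, Units.val_one, Units.val_neg] <;>
    grind

variable [Fintype ι]

theorem latticeStep_mem_weylChamber {a x : ι → ℤ} (hx : x ∈ weylChamber ι) {s : ι × ℤˣ}
    (h : (walkMatrix a (latticeStep x s)).det ≠ 0) : latticeStep x s ∈ weylChamber ι := by
  refine ⟨(antitone_latticeStep hx.1 s).strictAnti_of_injective
    (injective_of_det_walkMatrix_ne_zero h), fun i => ?_⟩
  refine lt_of_le_of_ne ?_ (ne_zero_of_det_walkMatrix_ne_zero h i).symm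
  have hpos := hx.2 i
  obtain ⟨l, ε⟩ := s
  rcases Int.units_eq_one_or ε with rfl | rfl <;>
    simp only [latticeStep, Function.update_apply, Units.val_one, Units.val_neg] <;>
    grind

theorem derivative_det_walkMatrix_eq_finsum {x : ι → ℤ} (a : ι → ℤ) (hx : x ∈ weylChamber ι) :
    d⁄dX ℚ (walkMatrix a x).det =
      ∑ᶠ y ∈ {y ∈ weylChamber ι | y ∈ Set.range (latticeStep x)}, (walkMatrix a y).det := by
  have mem_iff : ∀ y ∈ Function.support fun y => (walkMatrix a y).det,
      y ∈ {y ∈ weylChamber ι | y ∈ Set.range (latticeStep x)} ↔ y ∈ Set.range (latticeStep x) := by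
    refine fun y hy => ⟨And.right, fun hxy => ⟨?_, hxy⟩⟩
    obtain ⟨s, rfl⟩ := hxy
    exact latticeStep_mem_weylChamber hx hy
  rw [finsum_mem_inter_support_eq' _ _ _ mem_iff, finsum_mem_range (latticeStep_injective x),
    finsum_eq_sum_of_fintype, derivative_det_walkMatrix]

theorem constantCoeff_det_walkMatrix {a x : ι → ℤ} (ha : a ∈ weylChamber ι)
    (hx : x ∈ weylChamber ι) :
    constantCoeff (walkMatrix a x).det = if x = a then 1 else 0 := by
  rw [RingHom.map_det]
  split_ifs with hxa
  · subst hxa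
    convert Matrix.det_one (n := ι) (R := ℚ)
    ext i j
    simp [constantCoeff_walkMatrix ha.2 ha.2, Matrix.one_apply, ha.1.injective.eq_iff]
  · obtain ⟨j, hj⟩ : ∃ j, x j ∉ Set.range a := by
      by_contra! h
      exact hxa (eq_of_strictAnti_of_range_subset hx.1 ha.1 (Set.range_subset_iff.2 h))
    refine Matrix.det_eq_zero_of_column_eq_zero j fun i => ?_
    simp only [RingHom.mapMatrix_apply, Matrix.map_apply, constantCoeff_walkMatrix ha.2 hx.2]
    exact if_neg fun h => hj ⟨i, h⟩

end LinearOrder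

/-! ### Ferrers diagrams as points of the Weyl chamber -/

section Diagrams

variable {k : ℕ} {μ ν : YoungDiagram}

theorem exists_eq_update_add_one_iff {ι : Type*} [Fintype ι] [DecidableEq ι] {f g : ι → ℤ} :
    (∃ j, g = Function.update f j (f j + 1)) ↔ f ≤ g ∧ ∑ i, g i = ∑ i, f i + 1 := by
  have sum_update (j : ι) : ∑ i, Function.update f j (f j + 1) i = ∑ i, f i + 1 := by
    rw [Finset.sum_update_of_mem (Finset.mem_univ j), add_right_comm,
      ← Finset.sum_eq_add_sum_sdiff_singleton_of_mem (Finset.mem_univ j)]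
  constructor
  · rintro ⟨j, rfl⟩
    exact ⟨le_update_self_iff.2 (by lia), sum_update j⟩
  · rintro ⟨hfg, hsum⟩
    obtain ⟨j, -, hj⟩ : ∃ j ∈ Finset.univ, f j < g j :=
      Finset.exists_lt_of_sum_lt (by lia)
    have update_le : Function.update f j (f j + 1) ≤ g := update_le_iff.2 ⟨hj, fun i _ => hfg i⟩
    refine ⟨j, funext fun i => Eq.symm ?_⟩
    exact (Finset.sum_eq_sum_iff_of_le fun i _ => update_le i).1
      ((sum_update j).trans hsum.symm) i (Finset.mem_univ i)

theorem diagramHeight_le_iff : diagramHeight μ ≤ k ↔ ∀ i, k ≤ i → μ.rowLen i = 0 := by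
  have lt_height_iff (i : ℕ) : i < diagramHeight μ ↔ 0 < μ.rowLen i := by
    rw [diagramHeight, ← YoungDiagram.mem_iff_lt_colLen, YoungDiagram.mem_iff_lt_rowLen]
  simp only [← Nat.le_zero, ← not_lt, ← lt_height_iff]
  grind

theorem youngDiagram_le_iff_rowLen_le : μ ≤ ν ↔ ∀ i, μ.rowLen i ≤ ν.rowLen i := by
  refine ⟨fun h i => le_of_forall_lt fun j hj => ?_, fun h c hc => ?_⟩
  · exact YoungDiagram.mem_iff_lt_rowLen.1 (h (YoungDiagram.mem_iff_lt_rowLen.2 hj))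
  · exact YoungDiagram.mem_iff_lt_rowLen.2 ((YoungDiagram.mem_iff_lt_rowLen.1 hc).trans_le (h c.1))

theorem card_eq_sum_rowLen (hμ : diagramHeight μ ≤ k) : μ.card = ∑ i : Fin k, μ.rowLen i := by
  rw [Fin.sum_univ_eq_sum_range fun i => μ.rowLen i]
  simp only [YoungDiagram.rowLen_eq_card, YoungDiagram.row]
  refine Finset.card_eq_sum_card_fiberwise fun c (hc : c ∈ μ) => Finset.mem_coe.2 ?_
  have hlt := YoungDiagram.mem_iff_lt_rowLen.1 hc
  have hzero := diagramHeight_le_iff.1 hμ c.1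
  grind

theorem exists_rowLen_eq {f : Fin k → ℕ} (hf : Antitone f) :
    ∃ μ : YoungDiagram, diagramHeight μ ≤ k ∧ ∀ i : Fin k, μ.rowLen i = f i := by
  let μ := YoungDiagram.ofRowLens (List.ofFn f) hf.sortedGE_ofFn
  have lt_rowLen_iff (i j : ℕ) : j < μ.rowLen i ↔ ∃ h : i < k, j < f ⟨i, h⟩ := by
    simp [μ, ← YoungDiagram.mem_iff_lt_rowLen, YoungDiagram.mem_ofRowLens]
  refine ⟨μ, diagramHeight_le_iff.2 fun i hi => ?_, fun i => eq_of_forall_lt_iff fun j => ?_⟩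
  · by_contra hne
    have := (lt_rowLen_iff i 0).1 (Nat.pos_of_ne_zero hne)
    lia
  · simp [lt_rowLen_iff]

/-- The point `(λ₁ + k, λ₂ + k - 1, …, λₖ + 1)` that encodes a Ferrers diagram `λ` with at most `k`
rows. -/
def diagramPoint (k : ℕ) (μ : YoungDiagram) (i : Fin k) : ℤ :=
  μ.rowLen i + (k - i)

theorem le_iff_diagramPoint_le (hμ : diagramHeight μ ≤ k) :
    μ ≤ ν ↔ diagramPoint k μ ≤ diagramPoint k ν := by
  simp only [youngDiagram_le_iff_rowLen_le, Pi.le_def, diagramPoint, add_le_add_iff_right,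
    Nat.cast_le]
  refine ⟨fun h i => h i, fun h i => ?_⟩
  rcases lt_or_ge i k with hi | hi
  · exact h ⟨i, hi⟩
  · simp [diagramHeight_le_iff.1 hμ i hi]

theorem diagramPoint_mem_weylChamber (k : ℕ) (μ : YoungDiagram) :
    diagramPoint k μ ∈ weylChamber (Fin k) := by
  refine ⟨fun i j (hij : (i : ℕ) < j) => ?_, fun i => ?_⟩
  · have := μ.rowLen_anti i j hij.le
    simp only [diagramPoint]
    lia
  · have := i.isLt
    simp only [diagramPoint]
    lia

theorem antitone_add_val {x : Fin k → ℤ} (hx : StrictAnti x) :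
    Antitone fun i : Fin k => x i + i := by
  cases k with
  | zero => exact fun i => i.elim0
  | succ k =>
    refine Fin.antitone_iff_succ_le.2 fun i => ?_
    have := hx i.castSucc_lt_succ
    simp only [Fin.val_succ, Fin.val_castSucc]
    lia

theorem le_add_val_of_mem_weylChamber {x : Fin k → ℤ} (hx : x ∈ weylChamber (Fin k)) (i : Fin k) :
    k ≤ x i + i := by
  cases k with
  | zero => exact i.elim0
  | succ k =>
    have hlast := hx.2 (Fin.last k)
    have hle := antitone_add_val hx.1 (Fin.le_last i)
    simp only [Fin.val_last] at hle
    lia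

theorem bijOn_diagramPoint (k : ℕ) :
    Set.BijOn (diagramPoint k) {μ | diagramHeight μ ≤ k} (weylChamber (Fin k)) := by
  refine ⟨fun μ _ => diagramPoint_mem_weylChamber k μ, fun μ hμ ν hν h => ?_, fun x hx => ?_⟩
  · exact le_antisymm ((le_iff_diagramPoint_le hμ).2 h.le) ((le_iff_diagramPoint_le hν).2 h.ge)
  · have rowLen_antitone : Antitone fun i : Fin k => (x i + i - k).toNat := fun i j hij =>
      Int.toNat_le_toNat (sub_le_sub_right (antitone_add_val hx.1 hij) _)
    obtain ⟨μ, hμ, hrow⟩ := exists_rowLen_eq rowLen_antitone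
    refine ⟨μ, hμ, funext fun i => ?_⟩
    have := le_add_val_of_mem_weylChamber hx i
    rw [diagramPoint, hrow]
    lia

theorem addsBox_iff_exists_latticeStep (hμ : diagramHeight μ ≤ k) (hν : diagramHeight ν ≤ k) :
    AddsBox μ ν ↔ ∃ j, diagramPoint k ν = latticeStep (diagramPoint k μ) (j, 1) := by
  simp only [latticeStep, Units.val_one, exists_eq_update_add_one_iff, AddsBox,
    le_iff_diagramPoint_le hμ, card_eq_sum_rowLen hμ, card_eq_sum_rowLen hν]
  refine and_congr_right fun _ => ?_
  simp only [diagramPoint, Finset.sum_add_distrib, ← Nat.cast_sum]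
  lia

/-- One step of an oscillating tableau: a box is added or deleted. -/
def IsOscillatingStep (μ ν : YoungDiagram) : Prop :=
  AddsBox μ ν ∨ AddsBox ν μ

theorem isOscillatingStep_iff (hμ : diagramHeight μ ≤ k) (hν : diagramHeight ν ≤ k) :
    IsOscillatingStep μ ν ↔ diagramPoint k μ ∈ Set.range (latticeStep (diagramPoint k ν)) := by
  rw [IsOscillatingStep, addsBox_iff_exists_latticeStep hμ hν, addsBox_iff_exists_latticeStep hν hμ]
  simp only [← eq_latticeStep_neg_iff (x := diagramPoint k ν)]
  constructor
  · rintro (⟨j, h⟩ | ⟨j, h⟩)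
    exacts [⟨(j, -1), h.symm⟩, ⟨(j, 1), h.symm⟩]
  · rintro ⟨⟨j, ε⟩, h⟩
    rcases Int.units_eq_one_or ε with rfl | rfl
    exacts [Or.inr ⟨j, h.symm⟩, Or.inl ⟨j, h.symm⟩]

theorem bijOn_diagramPoint_neighbors (hν : diagramHeight ν ≤ k) :
    Set.BijOn (diagramPoint k) {μ ∈ {μ | diagramHeight μ ≤ k} | IsOscillatingStep μ ν}
      {x ∈ weylChamber (Fin k) | x ∈ Set.range (latticeStep (diagramPoint k ν))} := by
  convert (bijOn_diagramPoint k).subset_right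
    (Set.sep_subset _ (· ∈ Set.range (latticeStep (diagramPoint k ν)))) using 1
  ext μ
  exact and_congr_right fun hμ => (isOscillatingStep_iff hμ hν).trans
    (and_iff_right (diagramPoint_mem_weylChamber k μ)).symm

theorem finite_isOscillatingStep (hν : diagramHeight ν ≤ k) :
    {μ ∈ {μ | diagramHeight μ ≤ k} | IsOscillatingStep μ ν}.Finite :=
  (bijOn_diagramPoint_neighbors hν).finite_iff_finite.2
    ((Set.finite_range _).subset fun _ h => h.2)

theorem ncard_pathsIn_isOscillatingStep (n : ℕ) (hμ : diagramHeight μ ≤ k)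
    (hν : diagramHeight ν ≤ k) :
    ((pathsIn {μ | diagramHeight μ ≤ k} IsOscillatingStep n μ ν).ncard : ℚ) =
      n ! * coeff n (walkMatrix (diagramPoint k μ) (diagramPoint k ν)).det := by
  classical
  refine ncard_pathsIn_eq_factorial_mul_coeff
    (F := fun ν => (walkMatrix (diagramPoint k μ) (diagramPoint k ν)).det)
    (fun _ => finite_isOscillatingStep) (fun ν hν => ?_) (fun ν hν => ?_) hν
  · simp only [constantCoeff_det_walkMatrix (diagramPoint_mem_weylChamber k μ)
      (diagramPoint_mem_weylChamber k ν), (bijOn_diagramPoint k).injOn.eq_iff hν hμ]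
  · rw [derivative_det_walkMatrix_eq_finsum _ (diagramPoint_mem_weylChamber k ν)]
    exact (finsum_mem_eq_of_bijOn _ (bijOn_diagramPoint_neighbors hν) fun _ _ => rfl).symm

end Diagrams

/-! ### Row shapes -/

/-- The row shape `(m)`. -/
def rowShape (m : ℕ) : YoungDiagram :=
  YoungDiagram.ofRowLens [m] (List.pairwise_singleton _ m).sortedGE

theorem mem_rowShape {m : ℕ} {c : ℕ × ℕ} : c ∈ rowShape m ↔ c.1 = 0 ∧ c.2 < m := by
  simp [rowShape, YoungDiagram.mem_ofRowLens]

theorem isRowShape_iff {μ : YoungDiagram} : IsRowShape μ ↔ ∃ m, μ = rowShape m :=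
  exists_congr fun _ => by simp only [SetLike.ext_iff, mem_rowShape]

theorem rowLen_rowShape (m i : ℕ) : (rowShape m).rowLen i = if i = 0 then m else 0 := by
  refine eq_of_forall_lt_iff fun j => ?_
  rw [← YoungDiagram.mem_iff_lt_rowLen, mem_rowShape]
  split_ifs with hi <;> simp [hi]

theorem rowShape_injective : Function.Injective rowShape := fun m m' h => by
  simpa only [rowLen_rowShape, if_true] using congrArg (YoungDiagram.rowLen · 0) h

theorem diagramHeight_rowShape_le (k m : ℕ) : diagramHeight (rowShape m) ≤ k + 1 :=
  diagramHeight_le_iff.2 fun i hi => by rw [rowLen_rowShape, if_neg (by lia)]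

theorem rowShape_zero : rowShape 0 = ⊥ := by
  ext c
  simp [mem_rowShape]

/-- The matrix whose determinant is the exponential generating function, by length, of the
oscillating tableaux of height at most `k + 1` that end in the row shape `(m)`. -/
noncomputable abbrev rowShapeMatrix (k m : ℕ) : Matrix (Fin (k + 1)) (Fin (k + 1)) ℚ⟦X⟧ :=
  walkMatrix (diagramPoint (k + 1) (rowShape 0)) (diagramPoint (k + 1) (rowShape m))

theorem rowShapeMatrix_apply_zero (k m : ℕ) (i : Fin (k + 1)) :
    rowShapeMatrix k m i 0 =
      besselB (m + i : ℕ) - besselB (m + (2 * (k + 1) - i) : ℕ) := by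
  have hi := i.isLt
  simp only [walkMatrix, Matrix.of_apply, diagramPoint, rowLen_rowShape, ite_self, Fin.val_zero,
    if_true, Nat.cast_zero, zero_add]
  rw [← besselB_neg]
  congr 2 <;> lia

theorem submatrix_rowShapeMatrix (k m : ℕ) (u : Fin (k + 1)) :
    (rowShapeMatrix k m).submatrix u.succAbove Fin.succ = rowMinor (k + 1) u := by
  ext1 r c
  have val_succAbove : (u.succAbove r : ℕ) = skipIndex u r := by
    simp only [Fin.succAbove, skipIndex, Fin.lt_def, Fin.val_castSucc]
    split_ifs <;> simp
  simp only [Matrix.submatrix_apply, walkMatrix, Matrix.of_apply, rowMinor, diagramPoint,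
    rowLen_rowShape, ite_self, Fin.val_succ, Nat.succ_ne_zero, if_false, val_succAbove]
  rw [← besselB_neg]
  congr 2 <;> push_cast <;> ring

theorem det_rowShapeMatrix (k m : ℕ) :
    (rowShapeMatrix k m).det =
      ∑ u : Fin (k + 1), (-1) ^ (u : ℕ) *
        (besselB (m + u : ℕ) - besselB (m + (2 * (k + 1) - u) : ℕ)) * (rowMinor (k + 1) u).det := by
  simp only [Matrix.det_succ_column_zero, rowShapeMatrix_apply_zero, submatrix_rowShapeMatrix]

theorem hasSum_det_rowShapeMatrix (k : ℕ) :
    HasSum (fun m => (rowShapeMatrix k m).det)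
      (∑ u ∈ Finset.range (k + 1), (-1 : ℚ⟦X⟧) ^ u *
        (∑ l ∈ Finset.Icc u (2 * (k + 1) - 1 - u), besselB l) * (rowMinor (k + 1) u).det) := by
  simp only [det_rowShapeMatrix]
  rw [← Fin.sum_univ_eq_sum_range fun u => (-1 : ℚ⟦X⟧) ^ u *
    (∑ l ∈ Finset.Icc u (2 * (k + 1) - 1 - u), besselB l) * (rowMinor (k + 1) u).det]
  refine hasSum_sum fun u _ => HasSum.mul_right _ (HasSum.mul_left _ ?_)
  have Icc_eq_Ico : Finset.Icc (u : ℕ) (2 * (k + 1) - 1 - u) =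
      Finset.Ico (u : ℕ) (2 * (k + 1) - u) := by
    ext l
    simp only [Finset.mem_Icc, Finset.mem_Ico]
    lia
  rw [Icc_eq_Ico]
  exact hasSum_sub_shift summable_besselB_natCast (by lia)

theorem coeff_det_rowShapeMatrix_eq_zero (k : ℕ) {m n : ℕ} (h : n < m) :
    coeff n (rowShapeMatrix k m).det = 0 := by
  have X_pow_dvd_besselB {j : ℕ} (hj : m ≤ j) : (X : ℚ⟦X⟧) ^ m ∣ besselB j :=
    X_pow_dvd_iff.2 fun p hp => coeff_besselB_eq_zero (by lia)
  refine X_pow_dvd_iff.1 ?_ n h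
  rw [det_rowShapeMatrix]
  exact Finset.dvd_sum fun u _ => ((dvd_sub (X_pow_dvd_besselB (by lia))
    (X_pow_dvd_besselB (by lia))).mul_left _).mul_right _

theorem pathsIn_rowShape_eq_empty (k : ℕ) {m n : ℕ} (h : n < m) :
    pathsIn {μ | diagramHeight μ ≤ k + 1} IsOscillatingStep n (rowShape 0) (rowShape m) = ∅ := by
  have card_eq := ncard_pathsIn_isOscillatingStep n (diagramHeight_rowShape_le k 0)
    (diagramHeight_rowShape_le k m)
  rw [coeff_det_rowShapeMatrix_eq_zero k h, mul_zero, Nat.cast_eq_zero] at card_eq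
  exact (Set.ncard_eq_zero (finite_pathsIn (fun _ => finite_isOscillatingStep)
    (diagramHeight_rowShape_le k m))).1 card_eq

theorem rowOscillatingTableaux_eq_biUnion (k n : ℕ) :
    rowOscillatingTableaux (k + 1) n = ⋃ m ∈ Finset.range (n + 1),
      pathsIn {μ | diagramHeight μ ≤ k + 1} IsOscillatingStep n (rowShape 0) (rowShape m) := by
  ext T
  simp only [Set.mem_iUnion, exists_prop, Finset.mem_range_succ_iff]
  constructor
  · rintro ⟨⟨hT, hstep⟩, hheight, hrow⟩
    obtain ⟨m, hm⟩ := isRowShape_iff.1 hrow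
    have hmem : T ∈ pathsIn {μ | diagramHeight μ ≤ k + 1} IsOscillatingStep n _ _ :=
      ⟨hT.trans rowShape_zero.symm, hm, hheight, hstep⟩
    refine ⟨m, not_lt.1 fun hlt => ?_, hmem⟩
    rwa [pathsIn_rowShape_eq_empty k hlt] at hmem
  · rintro ⟨m, -, hT, hm, hheight, hstep⟩
    exact ⟨⟨hT.trans rowShape_zero, hstep⟩, hheight, isRowShape_iff.2 ⟨m, hm⟩⟩

theorem coeff_rowOscillatingEGF (k n : ℕ) :
    coeff n (rowOscillatingEGF (k + 1)) =
      ∑ m ∈ Finset.range (n + 1), coeff n (rowShapeMatrix k m).det := by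
  rw [rowOscillatingEGF, coeff_mk, rowOscillatingTableaux_eq_biUnion,
    div_eq_iff (Nat.cast_ne_zero.2 n.factorial_ne_zero), mul_comm, Finset.mul_sum]
  simp only [← Finset.mem_coe (s := Finset.range (n + 1))]
  rw [(Finset.finite_toSet _).ncard_biUnion, finsum_mem_coe_finset, Nat.cast_sum]
  · exact Finset.sum_congr rfl fun m _ => ncard_pathsIn_isOscillatingStep n
      (diagramHeight_rowShape_le k 0) (diagramHeight_rowShape_le k m)
  · exact fun m _ =>
      finite_pathsIn (fun _ => finite_isOscillatingStep) (diagramHeight_rowShape_le k m)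
  · exact fun m _ m' _ hne => pairwise_disjoint_pathsIn (rowShape_injective.ne hne)

theorem hasSum_rowOscillatingEGF (k : ℕ) :
    HasSum (fun m => (rowShapeMatrix k m).det) (rowOscillatingEGF (k + 1)) := by
  refine (WithPiTopology.hasSum_iff_hasSum_coeff ℚ).2 fun n => ?_
  rw [coeff_rowOscillatingEGF]
  refine hasSum_sum_of_ne_finset_zero fun m hm => ?_
  exact coeff_det_rowShapeMatrix_eq_zero k (by simpa using hm)

theorem mainTheorem5 (k : ℕ) (hk : 1 ≤ k) :
    rowOscillatingEGF k =
      ∑ u ∈ Finset.range k,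
        (-1 : PowerSeries ℚ) ^ u * (∑ l ∈ Finset.Icc u (2 * k - 1 - u), besselB (l : ℤ)) *
          (rowMinor k u).det := by
  obtain ⟨k, rfl⟩ := Nat.exists_eq_add_of_le' hk
  exact (hasSum_rowOscillatingEGF k).unique (hasSum_det_rowShapeMatrix k)
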